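/- All graphs are finite and simple; $d_G(u)$ denotes the degree of $u$ in $G$. The skeleton of a graph is obtained by deleting all leaves and isolated vertices. A sunshine graph is a connected graph whose skeleton is a cycle; a caterpillar is a connected graph whose skeleton is a path (with at least one vertex). Let $U$ be a sunshine graph, let $T$ be a caterpillar, and let $U^+$ be a sunshine graph with vertices $w$ and $v$ such that $U^+-w\cong U$ and $U^+-v\cong T$ (so $w$ is a leaf, and $v$ is a vertex of degree $2$ on the cycle). Label the skeleton of $U^+$ cyclically as $x_0x_1\ldots x_{c-1}x_0$, with indices modulo $c$, so that $x_0$ is the neighbour of $w$ (thus $v=x_\nu$ for some $\nu\neq 0$), and label the leaves adjacent to $x_i$ arbitrarily, without repetition, as $x_i^j$ with $1\le j\le d_{U^+}(x_i)-2$, where $x_0^1=w$. Let $B_{vw}(U^+)$ be the set of permutations $\lambda$ of $V(U^+)$ that restrict to an isomorphism from $(U^+-w)-\lambda^{-1}(v)$ onto $(U^+-v)-\lambda(w)$, and let $B_U$ be the set of those $\lambda\in B_{vw}(U^+)$ that also restrict to an isomorphism from $U^+-w$ onto $U^+-\lambda(w)$. A maximum saturating set of $B_{vw}(U^+)$ is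 a subset $X\subseteq B_{vw}(U^+)$ containing the identity such that $\lambda^{-1}(v)\ne\pi^{-1}(v)$ and $\lambda(w)\neq\pi(w)$ for all distinct $\lambda,\pi\in X$, and such that no $X\cup\{\sigma\}$ with $\sigma\in B_{vw}(U^+)\setminus X$ still has this last property. It is $U^+$-optimum if $|X\cap B_U|$ is largest among all maximum saturating sets. Put $X_{\mathrm{Aut}}=X\cap\mathrm{Aut}(U^+)$. Let $\mathrm{Rot}$ (respectively $\mathrm{Ref}$) be the set of all $\lambda\in\mathrm{Aut}(U^+)$ for which there is an $\alpha$ with $\lambda(x_i)=x_{\alpha+i}$ for all $i$ (respectively $\lambda(x_i)=x_{\alpha-i}$ for all $i$). For a set $Z$ of permutations write $Z(u)=\{\lambda(u)\mid\lambda\in Z\}$. Suppose that $\mathrm{Rot}$ contains a non-trivial rotation, i.e. one with $\lambda(x_0)\ne x_0$, and let $\delta$ be the smallest positive integer with $x_\delta\in\mathrm{Rot}(x_0)$. Then $\delta$ divides $c$, there is an automorphism $\phi\in\mathrm{Rot}$ with $\phi(x_i)=x_{\delta+i}$ and $\phi(x_i^j)=x_{\delta+i}^j$ for all $i,j$, and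 the group $\Phi$ generated by $\phi$ has order $c/\delta$. Consider the two cases (i) $\mathrm{Ref}(v)\subseteq\Phi(v)$; (ii) $d_{U^+}(x_0)=3$ and $\mathrm{Ref}(x_0)\subseteq\Phi(x_0)$. (a) If (i) or (ii) holds, then there is a $U^+$-optimum saturating set $X$ of $B_{vw}(U^+)$ such that $X_{\mathrm{Aut}}=\Phi$, which is isomorphic to the cyclic group of order $c/\delta$. (b) If neither (i) nor (ii) holds, then there are $\pi\in\mathrm{Ref}$ and a $U^+$-optimum saturating set $X$ of $B_{vw}(U^+)$ such that $X_{\mathrm{Aut}}=\Phi\cup\Phi\pi$, where $\Phi\pi=\{\psi\pi\mid\psi\in\Phi\}$, and $X_{\mathrm{Aut}}$ is a group isomorphic to the dihedral group of order $2c/\delta$ (the Klein four-group when $c/\delta=2$). -/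

import Mathlib

namespace Supercard

open SimpleGraph

section Graphs

variable {V : Type*}

/-- The degree of a vertex (all graphs below are finite). -/
noncomputable def deg (G : SimpleGraph V) (u : V) : ℕ := (G.neighborSet u).ncard

/-- The vertex-deleted subgraph `G - u`, i.e. a card of `G`. -/
def deleteVertex (G : SimpleGraph V) (u : V) : SimpleGraph ({u}ᶜ : Set V) := G.induce {u}ᶜ

/-- The vertices of the skeleton: all vertices that are neither leaves nor isolated. -/
def skelVerts (G : SimpleGraph V) : Set V := {u | deg G u ≠ 0 ∧ deg G u ≠ 1}

/-- The skeleton: the graph that remains when all leaves and isolated vertices are deleted. -/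
def skel (G : SimpleGraph V) : SimpleGraph (skelVerts G) := G.induce (skelVerts G)

/-- A sunshine graph is a connected graph whose skeleton is a cycle. -/
def IsSunshine (G : SimpleGraph V) : Prop :=
  G.Connected ∧ ∃ c : ℕ, 3 ≤ c ∧ Nonempty (skel G ≃g cycleGraph c)

/-- A caterpillar is a connected graph whose skeleton is a path. -/
def IsCaterpillar (G : SimpleGraph V) : Prop :=
  G.Connected ∧ ∃ p : ℕ, 1 ≤ p ∧ Nonempty (skel G ≃g pathGraph p)

end Graphs

section Saturating

variable {V : Type*}

/-- `σ(G[A]) = G[B]`: the permutation `σ` restricts to an isomorphism from the subgraph of `G`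
induced by `A` onto the subgraph induced by `B`. -/
def MapsOnto (G : SimpleGraph V) (σ : Equiv.Perm V) (A B : Set V) : Prop :=
  σ '' A = B ∧ ∀ a ∈ A, ∀ b ∈ A, G.Adj (σ a) (σ b) ↔ G.Adj a b

/-- The automorphisms of `G`, as a set of permutations of the vertices. -/
def autSet (G : SimpleGraph V) : Set (Equiv.Perm V) :=
  {σ | ∀ a b, G.Adj (σ a) (σ b) ↔ G.Adj a b}

/-- The active permutations of `G` with respect to `v` and `w`: those `σ` with
`σ((G - w) - σ⁻¹(v)) = (G - v) - σ(w)`. -/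
def active (G : SimpleGraph V) (v w : V) : Set (Equiv.Perm V) :=
  {σ | MapsOnto G σ ({w}ᶜ \ {σ⁻¹ v}) ({v}ᶜ \ {σ w})}

/-- The active permutations `σ` that moreover satisfy `σ(G - w) = G - σ(w)`. -/
def activeIso (G : SimpleGraph V) (v w : V) : Set (Equiv.Perm V) :=
  {σ | σ ∈ active G v w ∧ MapsOnto G σ {w}ᶜ {σ w}ᶜ}

/-- Distinct members of `X` have distinct preimages of `v` and distinct images of `w`. -/
def Separated (v w : V) (X : Set (Equiv.Perm V)) : Prop :=
  ∀ σ ∈ X, ∀ τ ∈ X, σ ≠ τ → σ⁻¹ v ≠ τ⁻¹ v ∧ σ w ≠ τ w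

/-- Maximum saturating sets of the set of active permutations. -/
structure IsMaxSaturating (G : SimpleGraph V) (v w : V) (X : Set (Equiv.Perm V)) : Prop where
  subset : X ⊆ active G v w
  one_mem : 1 ∈ X
  separated : Separated v w X
  maximal : ¬ ∃ σ ∈ active G v w \ X, Separated v w (insert σ X)

/-- `G`-optimum saturating sets: maximum saturating sets `X` for which the number of elements `σ`
with `σ(G - w) = G - σ(w)` is as large as possible. -/
def IsOptimum (G : SimpleGraph V) (v w : V) (X : Set (Equiv.Perm V)) : Prop :=
  IsMaxSaturating G v w X ∧
    ∀ Y, IsMaxSaturating G v w Y →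
      (Y ∩ activeIso G v w).ncard ≤ (X ∩ activeIso G v w).ncard

/-- `Z(u)`, the set of images of the vertex `u` under the members of `Z`. -/
def images (Z : Set (Equiv.Perm V)) (u : V) : Set V := (fun σ : Equiv.Perm V => σ u) '' Z

end Saturating

section Labelling

variable {V : Type*}

/-- A labelling of a sunshine graph with a distinguished leaf `w`. The skeleton is the cycle
`x 0, x 1, …, x (c - 1)`, with indices taken modulo `c`; the vertex `x 0` is the neighbour of `w`;
the leaves adjacent to `x i` are labelled, without repetition, as `leaf i j` for
`1 ≤ j ≤ deg (x i) - 2`; and `w` itself is labelled `leaf 0 1`.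
(The values `leaf i j` for other `j` have no meaning.) -/
structure Labelling (G : SimpleGraph V) (w : V) (c : ℕ) where
  x : ZMod c → V
  leaf : ZMod c → ℕ → V
  x_injective : Function.Injective x
  x_range : Set.range x = skelVerts G
  x_adj : ∀ i j, G.Adj (x i) (x j) ↔ j = i + 1 ∨ i = j + 1
  leaf_bijOn : ∀ i, Set.BijOn (leaf i) (Set.Icc 1 (deg G (x i) - 2))
    {u | deg G u = 1 ∧ G.Adj (x i) u}
  w_adj : G.Adj (x 0) w
  leaf_zero_one : leaf 0 1 = w

variable {G : SimpleGraph V} {w : V} {c : ℕ}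

/-- The automorphisms of `G` that act on the skeleton as rotations. -/
def Labelling.rot (L : Labelling G w c) : Set (Equiv.Perm V) :=
  {σ | σ ∈ autSet G ∧ ∃ α : ZMod c, ∀ i, σ (L.x i) = L.x (α + i)}

/-- The automorphisms of `G` that act on the skeleton as reflections. -/
def Labelling.ref (L : Labelling G w c) : Set (Equiv.Perm V) :=
  {σ | σ ∈ autSet G ∧ ∃ β : ZMod c, ∀ i, σ (L.x i) = L.x (β - i)}

/-- The smallest positive integer `δ` such that some rotation in `Aut(G)` maps `x 0` to `x δ`. -/
noncomputable def Labelling.delta (L : Labelling G w c) : ℕ :=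
  sInf {β : ℕ | 0 < β ∧ L.x (β : ZMod c) ∈ images L.rot (L.x 0)}

/-- The minimal rotation: the automorphism that maps `x i` to `x (δ + i)` and
`leaf i j` to `leaf (δ + i) j`. -/
def Labelling.IsMinimalRotation (L : Labelling G w c) (φ : Equiv.Perm V) : Prop :=
  φ ∈ L.rot ∧ (∀ i, φ (L.x i) = L.x (L.delta + i)) ∧
    ∀ i, ∀ j ∈ Set.Icc 1 (deg G (L.x i) - 2), φ (L.leaf i j) = L.leaf (L.delta + i) j

/-- Case (i): all reflections keep `v` inside its orbit under `Φ`. -/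
def Labelling.CaseOne (L : Labelling G w c) (v : V) (Φ : Subgroup (Equiv.Perm V)) : Prop :=
  images L.ref v ⊆ images (Φ : Set (Equiv.Perm V)) v

/-- Case (ii): `x 0` has degree `3` and all reflections keep `x 0` inside its orbit under `Φ`. -/
def Labelling.CaseTwo (L : Labelling G w c) (Φ : Subgroup (Equiv.Perm V)) : Prop :=
  deg G (L.x 0) = 3 ∧ images L.ref (L.x 0) ⊆ images (Φ : Set (Equiv.Perm V)) (L.x 0)

end Labelling

end Supercard

namespace Supercard

open SimpleGraph

/-! ### Automorphisms, separated sets, and injections of a cycle. -/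

section General

variable {V : Type*}

/-! A non-trivial rotation makes the degrees along the cycle periodic with period `δ ≠ 0` modulo
`c`. This removes the difference between `activeIso` and `autSet`
(`Labelling.activeIso_subset_autSet`): if `σ` carries `G - w` onto `G - σ w` but `σ w` is not
attached to `σ (x 0)`, then the degree drops by one from `x 0` to `σ (x 0)` and does not drop from
`x δ` to `σ (x δ)`, although each pair has equal degrees by periodicity. Optimum saturating sets are
therefore governed by the largest separated sets of automorphisms (`exists_isOptimum`).

Upper bounds come from counting the values of `σ⁻¹ v` or of `σ w`, which are distinct for distinct
members of a separated set. On the cycle every rotation agrees with an element of `Φ`, and every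
reflection with an element of `Φπ`, for any fixed reflection `π`. So `σ⁻¹ v` lies in `Φ(v) ∪ Φπ(v)`,
which is `Φ(v)` in case (i). In case (ii) `w` is the only leaf at `x 0`, so `σ w` is determined by
`σ (x 0)` and lies in `Φ(w)`. Since `Φ` acts freely on all vertices, it is separated and attains the
bound.

Outside both cases `π` is chosen to exchange the leaf labels 1 and 2 wherever both exist. Then `π v
∉ Φ(v)` and `π w ∉ Φ(w)`, so no non-trivial element of the dihedral group `Φ ∪ Φπ` fixes `v` or `w`.
Hence this group is separated, and the bound from `σ⁻¹ v` shows that it is largest possible.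

The hypotheses on the cards enter only to place `w` off the cycle and `v` on it: a cycle does not
embed into a path. -/

theorem autSet_one (G : SimpleGraph V) : (1 : Equiv.Perm V) ∈ autSet G := fun _ _ => Iff.rfl

theorem autSet_mul {G : SimpleGraph V} {σ τ : Equiv.Perm V} (hσ : σ ∈ autSet G)
    (hτ : τ ∈ autSet G) : σ * τ ∈ autSet G := fun a b => (hσ (τ a) (τ b)).trans (hτ a b)

theorem autSet_inv {G : SimpleGraph V} {σ : Equiv.Perm V} (hσ : σ ∈ autSet G) :
    σ⁻¹ ∈ autSet G := fun a b => by
  have := hσ (σ⁻¹ a) (σ⁻¹ b)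
  simpa using this.symm

theorem deg_apply_of_mem_autSet {G : SimpleGraph V} {σ : Equiv.Perm V} (hσ : σ ∈ autSet G)
    (a : V) : deg G (σ a) = deg G a := by
  have : G.neighborSet (σ a) = σ '' G.neighborSet a := by
    ext b
    obtain ⟨b, rfl⟩ := σ.surjective b
    simp [hσ a b]
  rw [deg, this, Set.ncard_image_of_injective _ σ.injective, deg]

theorem autSet_subset_activeIso (G : SimpleGraph V) (v w : V) :
    autSet G ⊆ activeIso G v w := fun σ hσ => by
  refine ⟨⟨?_, fun a _ b _ => hσ a b⟩, ?_, fun a _ b _ => hσ a b⟩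
  · rw [Set.image_sdiff σ.injective, Set.image_compl_eq σ.bijective]
    ext a
    simp [and_comm]
  · rw [Set.image_compl_eq σ.bijective, Set.image_singleton]

theorem exists_isMaxSaturating_superset [Finite V] {G : SimpleGraph V} {v w : V}
    {M : Set (Equiv.Perm V)} (hM : M ⊆ active G v w) (h1 : 1 ∈ M) (hs : Separated v w M) :
    ∃ X, M ⊆ X ∧ IsMaxSaturating G v w X := by
  have hfin : {X : Set (Equiv.Perm V) | X ⊆ active G v w ∧ Separated v w X}.Finite :=
    Set.toFinite _
  obtain ⟨X, hMX, hX⟩ := hfin.exists_le_maximal (a := M) ⟨hM, hs⟩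
  refine ⟨X, hMX, hX.prop.1, hMX h1, hX.prop.2, ?_⟩
  rintro ⟨σ, ⟨hσ, hσX⟩, hsep⟩
  exact hσX (hX.le_of_ge (y := insert σ X) ⟨Set.insert_subset hσ hX.prop.1, hsep⟩
    (Set.subset_insert _ _) (Set.mem_insert _ _))

theorem Separated.mono {v w : V} {X Y : Set (Equiv.Perm V)} (h : X ⊆ Y) (hY : Separated v w Y) :
    Separated v w X := fun σ hσ τ hτ => hY σ (h hσ) τ (h hτ)

/-- If every permutation in `activeIso` is an automorphism, then a separated set of automorphisms
of largest size is the automorphism part of an optimum saturating set. -/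
theorem exists_isOptimum [Finite V] {G : SimpleGraph V} {v w : V}
    (hB : activeIso G v w ⊆ autSet G) {M : Set (Equiv.Perm V)} (hM : M ⊆ autSet G) (h1 : 1 ∈ M)
    (hs : Separated v w M)
    (hmax : ∀ Y ⊆ autSet G, Separated v w Y → Y.ncard ≤ M.ncard) :
    ∃ X, IsOptimum G v w X ∧ X ∩ autSet G = M := by
  have hBA : activeIso G v w = autSet G := hB.antisymm (autSet_subset_activeIso G v w)
  obtain ⟨X, hMX, hX⟩ := exists_isMaxSaturating_superset
    (fun σ hσ => (autSet_subset_activeIso G v w (hM hσ)).1) h1 hs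
  -- Extending `M` can add no automorphism, because `M` already has the largest possible size.
  have key : X ∩ autSet G = M :=
    (Set.eq_of_subset_of_ncard_le (Set.subset_inter hMX hM)
      (hmax _ Set.inter_subset_right (hX.separated.mono Set.inter_subset_left))
      (Set.toFinite _)).symm
  refine ⟨X, ⟨hX, fun Y hY => ?_⟩, key⟩
  rw [hBA, key]
  exact hmax _ Set.inter_subset_right (hY.separated.mono Set.inter_subset_left)

/-- Separation makes `σ ↦ σ⁻¹ v` injective on `X`, and an orbit `M(a)` has at most `|M|` points. The
next lemma is the counterpart for `σ ↦ σ w`. -/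
theorem Separated.ncard_le_of_inv_apply_mem [Finite V] {v w a : V} {X M : Set (Equiv.Perm V)}
    (hX : Separated v w X) (h : ∀ σ ∈ X, σ⁻¹ v ∈ images M a) : X.ncard ≤ M.ncard :=
  (Set.ncard_le_ncard_of_injOn (fun σ : Equiv.Perm V => σ⁻¹ v) h (fun σ hσ τ hτ he => by
    by_contra hne
    exact (hX σ hσ τ hτ hne).1 he) (Set.toFinite _)).trans (Set.ncard_image_le (Set.toFinite _))

theorem Separated.ncard_le_of_apply_mem [Finite V] {v w a : V} {X M : Set (Equiv.Perm V)}
    (hX : Separated v w X) (h : ∀ σ ∈ X, σ w ∈ images M a) : X.ncard ≤ M.ncard :=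
  (Set.ncard_le_ncard_of_injOn (fun σ : Equiv.Perm V => σ w) h (fun σ hσ τ hτ he => by
    by_contra hne
    exact (hX σ hσ τ hτ hne).2 he) (Set.toFinite _)).trans (Set.ncard_image_le (Set.toFinite _))

theorem two_ne_zero_zmod {c : ℕ} (hc : 3 ≤ c) : (2 : ZMod c) ≠ 0 := fun h => by
  have : ((2 : ℕ) : ZMod c) = 0 := by exact_mod_cast h
  have := Nat.le_of_dvd two_pos ((ZMod.natCast_eq_zero_iff 2 c).1 this)
  omega

/-- The adjacency preserving injections of a cycle are its rotations and reflections. -/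
theorem rotation_or_reflection {c : ℕ} (hc : 3 ≤ c) (τ : ZMod c → ZMod c)
    (hinj : Function.Injective τ) (hadj : ∀ i, τ (i + 1) = τ i + 1 ∨ τ i = τ (i + 1) + 1) :
    (∀ i, τ i = τ 0 + i) ∨ ∀ i, τ i = τ 0 - i := by
  have : NeZero c := ⟨by omega⟩
  have h2 := two_ne_zero_zmod hc
  -- Injectivity forbids turning back, so the direction of the first step persists.
  have hne : ∀ n : ℕ, τ ((n : ZMod c) + 1 + 1) ≠ τ n := fun n h => h2 (by
    have := hinj h
    linear_combination this)
  rcases hadj 0 with h0 | h0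
  · left
    have step : ∀ n : ℕ, τ ((n : ZMod c) + 1) = τ n + 1 := fun n => by
      induction n with
      | zero => simpa using h0
      | succ n ih =>
        push_cast
        refine (hadj _).resolve_right fun h => hne n ?_
        rw [ih] at h
        exact (add_right_cancel h).symm
    have all : ∀ n : ℕ, τ n = τ 0 + n := fun n => by
      induction n with
      | zero => simp
      | succ n ih => push_cast; rw [step, ih, add_assoc]
    intro i
    simpa using all i.val
  · right
    have step : ∀ n : ℕ, τ n = τ ((n : ZMod c) + 1) + 1 := fun n => by
      induction n with
      | zero => simpa using h0
      | succ n ih =>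
        push_cast
        refine (hadj _).resolve_left fun h => hne n ?_
        rw [h, ← ih]
    have all : ∀ n : ℕ, τ n = τ 0 - n := fun n => by
      induction n with
      | zero => simp
      | succ n ih =>
        push_cast
        have := step n
        linear_combination ih - this
    intro i
    simpa using all i.val

/-- A cycle does not embed into a path. -/
theorem not_exists_cycle_in_path {c p : ℕ} (hc : 3 ≤ c) (f : ZMod c → Fin p)
    (hf : Function.Injective f) (hadj : ∀ i, (pathGraph p).Adj (f i) (f (i + 1))) : False := by
  have : NeZero c := ⟨by omega⟩
  -- Both neighbours of a highest point would have to sit just below it, contradicting injectivity.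
  obtain ⟨i, hi⟩ := Finite.exists_max f
  have h1 := hadj i
  have h2 := hadj (i - 1)
  rw [sub_add_cancel] at h2
  rw [pathGraph_adj] at h1 h2
  have h3 : (f (i + 1)).val ≤ (f i).val := hi (i + 1)
  have h4 : (f (i - 1)).val ≤ (f i).val := hi (i - 1)
  have h5 := hf (Fin.ext (by omega : (f (i + 1)).val = (f (i - 1)).val))
  exact two_ne_zero_zmod hc (by linear_combination h5)

/-- In a connected graph a nonempty set of vertices without outgoing edges contains everything. -/
theorem mem_of_adj_closed {G : SimpleGraph V} (hG : G.Connected) {S : Set V}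
    (hS : ∀ a ∈ S, ∀ b, G.Adj a b → b ∈ S) {a : V} (ha : a ∈ S) (b : V) : b ∈ S := by
  obtain ⟨p⟩ := hG.preconnected a b
  induction p with
  | nil => exact ha
  | cons h _ ih => exact ih (hS _ ha _ h)

end General

/-! ### Recognising a dihedral group. -/

section Dihedral

variable {H : Type*} [Group H]

theorem conj_zpow_eq {a b : H} (hba : b * a = a⁻¹ * b) (k : ℤ) : b * a ^ k = a ^ (-k) * b := by
  have h : SemiconjBy b a a⁻¹ := hba
  have := h.zpow_right k
  rw [inv_zpow', SemiconjBy] at this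
  exact this

/-- An element `a` of order `m` and an involution `b` outside `⟨a⟩` that inverts `a` generate a
dihedral group. -/
theorem exists_dihedral_subgroup {a b : H} {m : ℕ} [NeZero m] (ha : orderOf a = m)
    (hb : b * b = 1) (hba : b * a = a⁻¹ * b) (hn : b ∉ Subgroup.zpowers a) :
    ∃ D : Subgroup H, (D : Set H) = (Subgroup.zpowers a : Set H) ∪
      (fun ψ => ψ * b) '' (Subgroup.zpowers a : Set H) ∧ Nonempty (D ≃* DihedralGroup m) := by
  have hmod : ∀ k l : ℤ, (k : ZMod m) = l → a ^ k = a ^ l := fun k l h => by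
    rwa [zpow_eq_zpow_iff_modEq, ha, ← ZMod.intCast_eq_intCast_iff]
  have hcomm : ∀ k : ℤ, a ^ k * b = b * a ^ (-k) := fun k => by
    rw [conj_zpow_eq hba, neg_neg]
  -- `sr i` stands for "`s` times `r i`", hence `b` on the left; the cosets in the conclusion have
  -- `b` on the right, which costs a sign in the exponent.
  let f : DihedralGroup m → H
    | .r i => a ^ (i.val : ℤ)
    | .sr i => b * a ^ (i.val : ℤ)
  have hmul : ∀ x y, f (x * y) = f x * f y := by
    rintro (i | i) (j | j)
    · simp only [DihedralGroup.r_mul_r, f]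
      rw [← zpow_add]
      exact hmod _ _ (by simp)
    · simp only [DihedralGroup.r_mul_sr, f]
      rw [← mul_assoc, hcomm, mul_assoc, ← zpow_add]
      exact congrArg _ (hmod _ _ (by simp; ring))
    · simp only [DihedralGroup.sr_mul_r, f]
      rw [mul_assoc, ← zpow_add]
      exact congrArg _ (hmod _ _ (by simp))
    · simp only [DihedralGroup.sr_mul_sr, f]
      rw [mul_assoc, ← mul_assoc _ b, hcomm, mul_assoc, ← zpow_add, ← mul_assoc, hb, one_mul]
      exact hmod _ _ (by simp; ring)
  let F : DihedralGroup m →* H := MonoidHom.mk' f hmul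
  have hinj : Function.Injective F := by
    rw [injective_iff_map_eq_one]
    rintro (i | i) h
    · have h : a ^ (i.val : ℤ) = 1 := h
      rw [zpow_natCast, ← orderOf_dvd_iff_pow_eq_one, ha] at h
      rw [DihedralGroup.one_def, ← ZMod.natCast_zmod_val i, (ZMod.natCast_eq_zero_iff _ _).2 h]
    · have h : b * a ^ (i.val : ℤ) = 1 := h
      exact absurd ⟨-(i.val : ℤ), by simp only [zpow_neg]; exact (eq_inv_of_mul_eq_one_left h).symm⟩ hn
  refine ⟨F.range, ?_, ⟨(MonoidHom.ofInjective hinj).symm⟩⟩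
  ext x
  constructor
  · rintro ⟨i | i, rfl⟩
    · exact Or.inl ⟨_, rfl⟩
    · exact Or.inr ⟨_, ⟨-(i.val : ℤ), rfl⟩, (conj_zpow_eq hba _).symm⟩
  · rintro (⟨k, rfl⟩ | ⟨_, ⟨k, rfl⟩, rfl⟩)
    · exact ⟨.r k, hmod _ _ (by simp)⟩
    · refine ⟨.sr ((-k : ℤ) : ZMod m), ?_⟩
      exact (congrArg (b * ·) (hmod _ (-k) (by simp))).trans (hcomm k).symm

end Dihedral

/-! ### The cycle, its leaves, and the positions of `v` and `w`. -/

section Structure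

variable {V : Type*} {G : SimpleGraph V} {w : V} {c : ℕ}

theorem eq_of_deg_eq_one {u a b : V} (hu : deg G u = 1) (ha : G.Adj a u) (hb : G.Adj b u) :
    a = b := by
  obtain ⟨d, hd⟩ := Set.ncard_eq_one.1 hu
  have ha' : a ∈ G.neighborSet u := ha.symm
  have hb' : b ∈ G.neighborSet u := hb.symm
  rw [hd] at ha' hb'
  exact ha'.trans hb'.symm

theorem mem_skelVerts_of_adj [Finite V] {u a b : V} (ha : G.Adj u a) (hb : G.Adj u b) (hab : a ≠ b) :
    u ∈ skelVerts G := by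
  constructor
  · intro h
    have : a ∈ G.neighborSet u := ha
    rw [(Set.ncard_eq_zero (Set.toFinite _)).1 h] at this
    exact this
  · exact fun h => hab (eq_of_deg_eq_one h ha.symm hb.symm)

namespace Labelling

theorem x_mem (L : Labelling G w c) (i : ZMod c) : L.x i ∈ skelVerts G :=
  L.x_range ▸ Set.mem_range_self i

theorem three_le (L : Labelling G w c) (hG : IsSunshine G) : 3 ≤ c := by
  obtain ⟨_, c', hc', ⟨e⟩⟩ := hG
  have h1 : Nat.card (skelVerts G) = c' := by simpa using Nat.card_congr e.toEquiv
  have h2 : Nat.card (skelVerts G) = c := by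
    rw [← L.x_range, Nat.card_congr (Equiv.ofInjective L.x L.x_injective).symm, Nat.card_zmod]
  omega

variable (L : Labelling G w c)

theorem adj_succ (i : ZMod c) : G.Adj (L.x i) (L.x (i + 1)) := (L.x_adj _ _).2 (Or.inl rfl)

theorem adj_pred (i : ZMod c) : G.Adj (L.x i) (L.x (i - 1)) :=
  (L.x_adj _ _).2 (Or.inr (by ring))

theorem x_succ_ne_x_pred (hc : 3 ≤ c) (i : ZMod c) : L.x (i + 1) ≠ L.x (i - 1) := fun h =>
  two_ne_zero_zmod hc (by linear_combination L.x_injective h)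

theorem two_le_deg (i : ZMod c) : 2 ≤ deg G (L.x i) := by
  have := L.x_mem i
  simp only [skelVerts, Set.mem_ofPred_eq] at this
  omega

theorem deg_eq_one [Finite V] (L : Labelling G w c) (hG : G.Connected) (hc : 3 ≤ c) {u : V} (hu : u ∉ skelVerts G) :
    deg G u = 1 := by
  have : Nontrivial V := ⟨⟨L.x (0 + 1), L.x (0 - 1), L.x_succ_ne_x_pred hc 0⟩⟩
  obtain ⟨a, ha⟩ := hG.preconnected.exists_adj_of_nontrivial u
  by_contra h1
  refine hu ⟨fun h0 => ?_, h1⟩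
  have : a ∈ G.neighborSet u := ha
  rw [(Set.ncard_eq_zero (Set.toFinite _)).1 h0] at this
  exact this

/-- The only alternative is that `u` hangs on another leaf; these two would then form a whole
component, but connectedness brings in `x 0`. -/
theorem exists_adj_x [Finite V] (hG : G.Connected) (hc : 3 ≤ c) {u : V} (hu : u ∉ skelVerts G) :
    ∃ i, G.Adj (L.x i) u := by
  have hu1 := L.deg_eq_one hG hc hu
  obtain ⟨a, ha⟩ := Set.ncard_eq_one.1 hu1
  have hua : G.Adj u a := by
    have : a ∈ G.neighborSet u := ha ▸ rfl
    exact this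
  by_cases hs : a ∈ skelVerts G
  · rw [← L.x_range] at hs
    obtain ⟨i, rfl⟩ := hs
    exact ⟨i, hua.symm⟩
  · have hclosed : ∀ b ∈ ({u, a} : Set V), ∀ d, G.Adj b d → d ∈ ({u, a} : Set V) := by
      rintro b (rfl | rfl) d hd
      · exact Or.inr (eq_of_deg_eq_one hu1 hd.symm hua.symm)
      · exact Or.inl (eq_of_deg_eq_one (L.deg_eq_one hG hc hs) hd.symm hua)
    rcases mem_of_adj_closed hG hclosed (Or.inl rfl) (L.x 0) with h | h
    · exact absurd (h ▸ L.x_mem 0) hu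
    · exact absurd (h ▸ L.x_mem 0) hs

theorem not_adj [Finite V] (L : Labelling G w c) (hG : G.Connected) (hc : 3 ≤ c) {u u' : V} (hu : u ∉ skelVerts G)
    (hu' : u' ∉ skelVerts G) : ¬ G.Adj u u' := fun h => by
  obtain ⟨i, hi⟩ := L.exists_adj_x hG hc hu
  exact hu' (eq_of_deg_eq_one (L.deg_eq_one hG hc hu) hi h.symm ▸ L.x_mem i)

/-- A permutation that preserves the adjacency of `G - w` acts on the cycle as a rotation or as a
reflection, and maps leaves to leaves. -/
theorem exists_action [Finite V] (hc : 3 ≤ c) {σ : Equiv.Perm V} (hw : w ∉ skelVerts G)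
    (hσ : ∀ a ∈ ({w}ᶜ : Set V), ∀ b ∈ ({w}ᶜ : Set V), G.Adj (σ a) (σ b) ↔ G.Adj a b) :
    (∃ α, (∀ i, σ (L.x i) = L.x (α + i)) ∨ ∀ i, σ (L.x i) = L.x (α - i)) ∧
      ∀ u, u ∉ skelVerts G → σ u ∉ skelVerts G := by
  have hne : ∀ i, L.x i ∈ ({w}ᶜ : Set V) := fun i h => hw (h ▸ L.x_mem i)
  have hσx : ∀ i j, G.Adj (σ (L.x i)) (σ (L.x j)) ↔ G.Adj (L.x i) (L.x j) :=
    fun i j => hσ _ (hne i) _ (hne j)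
  have hmaps : ∀ i, σ (L.x i) ∈ skelVerts G := fun i =>
    mem_skelVerts_of_adj ((hσx _ _).2 (L.adj_succ i)) ((hσx _ _).2 (L.adj_pred i))
      fun h => L.x_succ_ne_x_pred hc i (σ.injective h)
  -- An injection of a finite set into itself is onto, so vertices outside the skeleton cannot enter
  -- it.
  have hskel : σ '' skelVerts G = skelVerts G := by
    refine Set.eq_of_subset_of_ncard_le ?_ (Set.ncard_image_of_injective _ σ.injective).ge
      (Set.toFinite _)
    rintro _ ⟨a, ha, rfl⟩
    rw [← L.x_range] at ha
    obtain ⟨i, rfl⟩ := ha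
    exact hmaps i
  refine ⟨?_, fun u hu h => ?_⟩
  · have hτ : ∀ i, ∃ j, L.x j = σ (L.x i) := fun i => by
      have := hmaps i
      rwa [← L.x_range] at this
    choose τ hτ using hτ
    have hinj : Function.Injective τ := fun i j h =>
      L.x_injective (σ.injective (by rw [← hτ, ← hτ, h]))
    have hadj : ∀ i, τ (i + 1) = τ i + 1 ∨ τ i = τ (i + 1) + 1 := fun i => by
      rw [← L.x_adj, hτ, hτ, hσx]
      exact L.adj_succ i
    refine ⟨τ 0, (rotation_or_reflection hc τ hinj hadj).imp (fun h i => ?_) fun h i => ?_⟩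
    · rw [← hτ, h]
    · rw [← hτ, h]
  · rw [← hskel] at h
    obtain ⟨a, ha, hau⟩ := h
    exact hu (σ.injective hau ▸ ha)

/-- If `w` were `x k`, the cycle of `G - w` would lie inside the cycle of `G` with `x k` removed,
which is a path. -/
theorem w_notMem [Finite V] (L : Labelling G w c) (hc : 3 ≤ c) {W : Type*} {U : SimpleGraph W}
    (hU : IsSunshine U) (e : deleteVertex G w ≃g U) : w ∉ skelVerts G := fun hw => by
  have : NeZero c := ⟨by omega⟩
  rw [← L.x_range] at hw
  obtain ⟨k, hk⟩ := hw
  obtain ⟨_, c', hc', ⟨g⟩⟩ := hU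
  obtain ⟨n, rfl⟩ := Nat.exists_eq_add_of_le' hc'
  let y : ZMod (n + 3) → V := fun i => (e.symm (g.symm i).1).1
  have hy : Function.Injective y := fun i j h =>
    g.symm.injective (Subtype.ext (e.symm.injective (Subtype.ext h)))
  have hyw : ∀ i, y i ≠ w := fun i => (e.symm (g.symm i).1).2
  have hadj : ∀ i, G.Adj (y i) (y (i + 1)) := fun i => by
    have h1 : (cycleGraph (n + 3)).Adj i (i + 1 : ZMod (n + 3)) :=
      Or.inr (add_sub_cancel_left (G := ZMod (n + 3)) i 1)
    have h2 : U.Adj (g.symm i).1 (g.symm (i + 1 : ZMod (n + 3))).1 := g.symm.map_adj_iff.2 h1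
    exact e.symm.map_adj_iff.2 h2
  have hf : ∀ i, ∃ f, L.x f = y i := fun i => by
    have : y i ∈ skelVerts G := mem_skelVerts_of_adj (hadj i)
      (by simpa using (hadj (i - 1)).symm) fun h =>
        two_ne_zero_zmod hc' (by linear_combination hy h)
    rwa [← L.x_range] at this
  choose f hf using hf
  -- Measured from `k`, the index never becomes 0, so unit steps modulo `c` are unit steps of
  -- `ZMod.val`, without wrap-around.
  have hfk : ∀ i, f i - k ≠ 0 := fun i h =>
    hyw i ((hf i).symm.trans ((congrArg L.x (sub_eq_zero.1 h)).trans hk))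
  have hval : ∀ a : ZMod c, a + 1 ≠ 0 → (a + 1).val = a.val + 1 := fun a ha => by
    have : Fact (1 < c) := ⟨by omega⟩
    have hlt : a.val + 1 < c := by
      refine lt_of_le_of_ne (ZMod.val_lt a) fun h => ha ?_
      have h1 : ((a.val + 1 : ℕ) : ZMod c) = 0 := by rw [h, ZMod.natCast_self]
      simpa using h1
    rw [ZMod.val_add_of_lt (by rwa [ZMod.val_one]), ZMod.val_one]
  refine not_exists_cycle_in_path hc' (p := c) (fun i => ⟨(f i - k).val, ZMod.val_lt _⟩)
    (fun i j h => ?_) fun i => ?_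
  · have := sub_left_injective (ZMod.val_injective c (congrArg Fin.val h))
    exact hy (by rw [← hf, ← hf, this])
  · rw [pathGraph_adj]
    have h := hadj i
    rw [← hf, ← hf, L.x_adj] at h
    rcases h with h | h
    · left
      have := hval (f i - k) (by rw [sub_add_eq_add_sub, ← h]; exact hfk _)
      rw [sub_add_eq_add_sub, ← h] at this
      exact this.symm
    · right
      have := hval (f (i + 1) - k) (by rw [sub_add_eq_add_sub, ← h]; exact hfk _)
      rw [sub_add_eq_add_sub, ← h] at this
      exact this.symm

theorem mem_rot_or_mem_ref [Finite V] (hc : 3 ≤ c) (hw : w ∉ skelVerts G) {σ : Equiv.Perm V}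
    (hσ : σ ∈ autSet G) : σ ∈ L.rot ∨ σ ∈ L.ref := by
  obtain ⟨⟨α, h | h⟩, _⟩ := L.exists_action hc hw fun a _ b _ => hσ a b
  · exact Or.inl ⟨hσ, α, h⟩
  · exact Or.inr ⟨hσ, α, h⟩

/-- If the degrees along the cycle have a period, then every permutation that maps `G - w` onto
`G - σ w` is an automorphism. -/
theorem activeIso_subset_autSet [Finite V] (hG : G.Connected) (hc : 3 ≤ c) (hw : w ∉ skelVerts G) {v : V}
    {d : ZMod c} (hd : d ≠ 0) (hper : ∀ i, deg G (L.x (d + i)) = deg G (L.x i)) :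
    activeIso G v w ⊆ autSet G := by
  rintro σ ⟨_, _, hσ⟩
  obtain ⟨⟨α, hα⟩, hleaf⟩ := L.exists_action hc hw hσ
  have hne : ∀ i, L.x i ≠ w := fun i h => hw (h ▸ L.x_mem i)
  have hw1 := L.deg_eq_one hG hc hw
  have hσw1 := L.deg_eq_one hG hc (hleaf w hw)
  have hcard : ∀ i, (G.neighborSet (σ (L.x i)) \ {σ w}).ncard =
      (G.neighborSet (L.x i) \ {w}).ncard := fun i => by
    have : G.neighborSet (σ (L.x i)) \ {σ w} = σ '' (G.neighborSet (L.x i) \ {w}) := by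
      ext b
      obtain ⟨b, rfl⟩ := σ.surjective b
      by_cases hb : b = w
      · simp [hb]
      · simp [hb, hσ (L.x i) (hne i) b hb]
    rw [this, Set.ncard_image_of_injective _ σ.injective]
  have hadj0 : G.Adj (σ (L.x 0)) (σ w) := by
    by_contra hna
    -- Compare the vertices `x 0` and `x d`: only the former loses a neighbour when `w` is deleted,
    -- and by assumption `σ (x 0)` loses none when `σ w` is deleted.
    have h0 := hcard 0
    have h1 := hcard d
    rw [Set.sdiff_singleton_eq_self (s := G.neighborSet (σ (L.x 0))) hna,
      Set.ncard_sdiff_singleton_of_mem (s := G.neighborSet (L.x 0)) L.w_adj] at h0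
    rw [Set.sdiff_singleton_eq_self (s := G.neighborSet (L.x d)) fun h =>
      hd (L.x_injective (eq_of_deg_eq_one hw1 h L.w_adj))] at h1
    have h2 := Set.ncard_le_ncard (Set.sdiff_subset (s := G.neighborSet (σ (L.x d)))
      (t := {σ w})) (Set.toFinite _)
    have h3 : deg G (σ (L.x d)) = deg G (σ (L.x 0)) := by
      rcases hα with h | h
      · rw [h, h, add_comm, hper, add_zero]
      · rw [h, h, ← hper (α - d)]
        congr 2
        ring
    have h4 := hper 0
    rw [add_zero] at h4
    have h5 := L.two_le_deg 0
    unfold deg at h3 h4 h5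
    omega
  have key : ∀ a, a ≠ w → (G.Adj (σ a) (σ w) ↔ G.Adj a w) := fun a ha => by
    by_cases hs : a ∈ skelVerts G
    · rw [← L.x_range] at hs
      obtain ⟨i, rfl⟩ := hs
      constructor
      · intro h
        rw [σ.injective (eq_of_deg_eq_one hσw1 h hadj0)]
        exact L.w_adj
      · intro h
        rw [eq_of_deg_eq_one hw1 h L.w_adj]
        exact hadj0
    · exact iff_of_false (L.not_adj hG hc (hleaf a hs) (hleaf w hw)) (L.not_adj hG hc hs hw)
  intro a b
  by_cases ha : a = w
  · by_cases hb : b = w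
    · simp [ha, hb]
    · rw [ha, G.adj_comm, key b hb, G.adj_comm]
  · by_cases hb : b = w
    · rw [hb, key a ha]
    · exact hσ a ha b hb

/-- A vertex whose deletion leaves a caterpillar lies on the cycle. -/
theorem exists_x_eq [Finite V] (hc : 3 ≤ c) {v : V} {W : Type*} [Finite W] {T : SimpleGraph W}
    (hT : IsCaterpillar T) (e : deleteVertex G v ≃g T) : ∃ i, L.x i = v := by
  -- Otherwise the whole cycle survives in `G - v`, hence in the skeleton of `T`, a path.
  by_contra! hv
  obtain ⟨_, p, _, ⟨g⟩⟩ := hT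
  let y : ZMod c → W := fun i => e ⟨L.x i, hv i⟩
  have hy : Function.Injective y := fun i j h =>
    L.x_injective (congrArg Subtype.val (e.injective h))
  have hyadj : ∀ i j, T.Adj (y i) (y j) ↔ G.Adj (L.x i) (L.x j) := fun i j => e.map_adj_iff
  have hmem : ∀ i, y i ∈ skelVerts T := fun i =>
    mem_skelVerts_of_adj ((hyadj _ _).2 (L.adj_succ i)) ((hyadj _ _).2 (L.adj_pred i))
      fun h => L.x_succ_ne_x_pred hc i (congrArg L.x (hy h))
  refine not_exists_cycle_in_path hc (fun i => g ⟨y i, hmem i⟩) (fun i j h => ?_) fun i => ?_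
  · exact hy (congrArg Subtype.val (g.injective h))
  · exact g.map_adj_iff.2 ((hyadj _ _).2 (L.adj_succ i))

/-! ### Coordinates for the vertices, and automorphisms built from them. -/

/-- The set of all positions `(i, j)`, where `(i, 0)` stands for `x i` and `(i, j)` for
`leaf i j`. -/
def positions : Set (ZMod c × ℕ) := {p | p.2 ≤ deg G (L.x p.1) - 2}

open Classical in
/-- The vertex at a position. -/
noncomputable def vertexAt (p : ZMod c × ℕ) : V := if p.2 = 0 then L.x p.1 else L.leaf p.1 p.2

theorem vertexAt_zero (i : ZMod c) : L.vertexAt (i, 0) = L.x i := if_pos rfl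

theorem vertexAt_of_ne_zero (i : ZMod c) {j : ℕ} (hj : j ≠ 0) :
    L.vertexAt (i, j) = L.leaf i j := if_neg hj

theorem leaf_spec {i : ZMod c} {j : ℕ} (hp : (i, j) ∈ L.positions) (hj : j ≠ 0) :
    deg G (L.leaf i j) = 1 ∧ G.Adj (L.x i) (L.leaf i j) :=
  (L.leaf_bijOn i).mapsTo ⟨Nat.one_le_iff_ne_zero.2 hj, hp⟩

theorem leaf_notMem {i : ZMod c} {j : ℕ} (hp : (i, j) ∈ L.positions) (hj : j ≠ 0) :
    L.leaf i j ∉ skelVerts G := fun h => h.2 (L.leaf_spec hp hj).1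

theorem vertexAt_bijOn [Finite V] (hG : G.Connected) (hc : 3 ≤ c) :
    Set.BijOn L.vertexAt L.positions Set.univ := by
  refine ⟨Set.mapsTo_univ _ _, ?_, fun u _ => ?_⟩
  · rintro ⟨i, j⟩ hp ⟨i', j'⟩ hp' h
    by_cases hj : j = 0 <;> by_cases hj' : j' = 0
    · subst hj hj'
      rw [vertexAt_zero, vertexAt_zero] at h
      rw [L.x_injective h]
    · subst hj
      rw [vertexAt_zero, vertexAt_of_ne_zero _ _ hj'] at h
      exact absurd (h ▸ L.x_mem i) (L.leaf_notMem hp' hj')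
    · subst hj'
      rw [vertexAt_zero, vertexAt_of_ne_zero _ _ hj] at h
      exact absurd (h ▸ L.x_mem i') (L.leaf_notMem hp hj)
    · rw [vertexAt_of_ne_zero _ _ hj, vertexAt_of_ne_zero _ _ hj'] at h
      have h1 := L.leaf_spec hp hj
      have h2 := L.leaf_spec hp' hj'
      rw [← h] at h2
      obtain rfl := L.x_injective (eq_of_deg_eq_one h1.1 h1.2 h2.2)
      rw [(L.leaf_bijOn i).injOn ⟨Nat.one_le_iff_ne_zero.2 hj, hp⟩
        ⟨Nat.one_le_iff_ne_zero.2 hj', hp'⟩ h]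
  · by_cases hu : u ∈ skelVerts G
    · rw [← L.x_range] at hu
      obtain ⟨i, rfl⟩ := hu
      exact ⟨(i, 0), Nat.zero_le _, L.vertexAt_zero i⟩
    · obtain ⟨i, hi⟩ := L.exists_adj_x hG hc hu
      obtain ⟨j, hj, rfl⟩ := (L.leaf_bijOn i).surjOn ⟨L.deg_eq_one hG hc hu, hi⟩
      exact ⟨(i, j), hj.2, L.vertexAt_of_ne_zero i (by have := hj.1; omega)⟩

theorem adj_vertexAt [Finite V] (hG : G.Connected) (hc : 3 ≤ c) {p q : ZMod c × ℕ} (hp : p ∈ L.positions)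
    (hq : q ∈ L.positions) : G.Adj (L.vertexAt p) (L.vertexAt q) ↔
      (p.2 = 0 ∧ q.2 = 0 ∧ (q.1 = p.1 + 1 ∨ p.1 = q.1 + 1)) ∨
      (p.1 = q.1 ∧ (p.2 = 0 ∧ q.2 ≠ 0 ∨ p.2 ≠ 0 ∧ q.2 = 0)) := by
  obtain ⟨i, j⟩ := p
  obtain ⟨i', j'⟩ := q
  have aux : ∀ (i i' : ZMod c) (j : ℕ), (i', j) ∈ L.positions → j ≠ 0 →
      (G.Adj (L.x i) (L.leaf i' j) ↔ i = i') := fun i i' j h hj => by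
    have h1 := L.leaf_spec h hj
    exact ⟨fun h2 => L.x_injective (eq_of_deg_eq_one h1.1 h2 h1.2), fun h2 => h2 ▸ h1.2⟩
  by_cases hj : j = 0 <;> by_cases hj' : j' = 0
  · subst hj hj'
    simp [vertexAt_zero, L.x_adj]
  · subst hj
    rw [vertexAt_zero, vertexAt_of_ne_zero _ _ hj', aux _ _ _ hq hj']
    simp [hj']
  · subst hj'
    rw [vertexAt_zero, vertexAt_of_ne_zero _ _ hj, G.adj_comm, aux _ _ _ hp hj]
    simp [hj, eq_comm]
  · rw [vertexAt_of_ne_zero _ _ hj, vertexAt_of_ne_zero _ _ hj']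
    simp [hj, hj', L.not_adj hG hc (L.leaf_notMem hp hj) (L.leaf_notMem hq hj')]

/-- A degree preserving automorphism `τ` of the cycle, together with a permutation of the leaf
labels at each vertex, is induced by an automorphism of the graph. -/
theorem exists_aut [Finite V] (hG : G.Connected) (hc : 3 ≤ c) (τ : Equiv.Perm (ZMod c))
    (hτ : ∀ i j, (τ j = τ i + 1 ∨ τ i = τ j + 1) ↔ (j = i + 1 ∨ i = j + 1))
    (s : ZMod c → Equiv.Perm ℕ) (hs0 : ∀ i, s i 0 = 0)
    (hs : ∀ i j, s i j ≤ deg G (L.x i) - 2 ↔ j ≤ deg G (L.x i) - 2)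
    (hdeg : ∀ i, deg G (L.x (τ i)) = deg G (L.x i)) :
    ∃ σ ∈ autSet G, ∀ i j, (i, j) ∈ L.positions →
      σ (L.vertexAt (i, j)) = L.vertexAt (τ i, s i j) := by
  let e : L.positions ≃ V := Equiv.ofBijective (fun p => L.vertexAt p) <| by
    have h := L.vertexAt_bijOn hG hc
    refine ⟨fun p q hpq => Subtype.ext (h.injOn p.2 q.2 hpq), fun u => ?_⟩
    obtain ⟨p, hp, rfl⟩ := h.surjOn (Set.mem_univ u)
    exact ⟨⟨p, hp⟩, rfl⟩
  -- Since every `s i` fixes 0, this sends cycle positions to cycle positions and leaf positions to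
  -- leaf positions.
  let P : Equiv.Perm L.positions := Equiv.Perm.subtypePerm (Equiv.prodShear τ s) fun p => by
    change s p.1 p.2 ≤ deg G (L.x (τ p.1)) - 2 ↔ p.2 ≤ deg G (L.x p.1) - 2
    rw [hdeg, hs]
  have hP : ∀ p, e.permCongr P (e p) = e (P p) := fun p => by simp [Equiv.permCongr_apply]
  refine ⟨e.permCongr P, fun a b => ?_, fun i j h => hP ⟨(i, j), h⟩⟩
  obtain ⟨p, rfl⟩ := e.surjective a
  obtain ⟨q, rfl⟩ := e.surjective b
  rw [hP, hP]
  change G.Adj (L.vertexAt (P p).1) (L.vertexAt (P q).1) ↔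
    G.Adj (L.vertexAt p.1) (L.vertexAt q.1)
  rw [L.adj_vertexAt hG hc (P p).2 (P q).2, L.adj_vertexAt hG hc p.2 q.2]
  have h0 : ∀ i j, s i j = 0 ↔ j = 0 := fun i j =>
    ⟨fun h => (s i).injective (h.trans (hs0 i).symm), fun h => h ▸ hs0 i⟩
  change (s p.1.1 p.1.2 = 0 ∧ s q.1.1 q.1.2 = 0 ∧
      (τ q.1.1 = τ p.1.1 + 1 ∨ τ p.1.1 = τ q.1.1 + 1)) ∨ (τ p.1.1 = τ q.1.1 ∧
      (s p.1.1 p.1.2 = 0 ∧ s q.1.1 q.1.2 ≠ 0 ∨ s p.1.1 p.1.2 ≠ 0 ∧ s q.1.1 q.1.2 = 0)) ↔ _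
  simp only [ne_eq, h0, hτ, τ.injective.eq_iff]

theorem perm_ext [Finite V] (hG : G.Connected) (hc : 3 ≤ c) {σ τ : Equiv.Perm V}
    (h : ∀ i j, (i, j) ∈ L.positions → σ (L.vertexAt (i, j)) = τ (L.vertexAt (i, j))) :
    σ = τ := by
  ext u
  obtain ⟨⟨i, j⟩, hp, rfl⟩ := (L.vertexAt_bijOn hG hc).surjOn (Set.mem_univ u)
  exact h i j hp

end Labelling

end Structure

/-! ### The minimal rotation, the group it generates, and reflections. -/

theorem exists_pow_of_mem_zpowers {H : Type*} [Group H] [Finite H] {a b : H}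
    (hb : b ∈ Subgroup.zpowers a) : ∃ n : ℕ, a ^ n = b := by
  rw [← mem_powers_iff_mem_zpowers] at hb
  exact hb

theorem autSet_pow {V : Type*} {G : SimpleGraph V} {σ : Equiv.Perm V} (hσ : σ ∈ autSet G) (n : ℕ) : σ ^ n ∈ autSet G := by
  induction n with
  | zero => exact autSet_one G
  | succ n ih => exact pow_succ σ n ▸ autSet_mul ih hσ

theorem mem_autSet_of_mem_zpowers {V : Type*} {G : SimpleGraph V} [Finite V] {φ ψ : Equiv.Perm V} (hφ : φ ∈ autSet G)
    (hψ : ψ ∈ Subgroup.zpowers φ) : ψ ∈ autSet G := by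
  obtain ⟨n, rfl⟩ := exists_pow_of_mem_zpowers hψ
  exact autSet_pow hφ n

namespace Labelling

variable {V : Type*} {G : SimpleGraph V} {w : V} {c : ℕ} (L : Labelling G w c)

theorem pow_apply_x {σ : Equiv.Perm V} {α : ZMod c} (h : ∀ i, σ (L.x i) = L.x (α + i)) (n : ℕ)
    (i : ZMod c) : (σ ^ n) (L.x i) = L.x (n * α + i) := by
  induction n generalizing i with
  | zero => simp
  | succ n ih =>
    rw [pow_succ, Equiv.Perm.mul_apply, h, ih]
    congr 1
    push_cast
    ring

theorem delta_le {n : ℕ} (hn : 0 < n) {σ : Equiv.Perm V} (hσ : σ ∈ autSet G)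
    (h : ∀ i, σ (L.x i) = L.x (n + i)) : L.delta ≤ n :=
  Nat.sInf_le ⟨hn, σ, ⟨hσ, n, h⟩, by simp [h]⟩

theorem delta_spec (hc : c ≠ 0) : 0 < L.delta ∧
    ∃ σ ∈ autSet G, ∀ i, σ (L.x i) = L.x (L.delta + i) := by
  have hne : {β : ℕ | 0 < β ∧ L.x (β : ZMod c) ∈ images L.rot (L.x 0)}.Nonempty :=
    -- The identity is the rotation by `c`, so the infimum is over a nonempty set.
    ⟨c, Nat.pos_of_ne_zero hc, 1, ⟨autSet_one G, 0, by simp⟩, by simp⟩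
  obtain ⟨hpos, σ, ⟨hσ, α, hα⟩, h0⟩ := Nat.sInf_mem hne
  refine ⟨hpos, σ, hσ, ?_⟩
  have : α = L.delta := L.x_injective (by rw [← add_zero α, ← hα]; exact h0)
  rwa [← this]

/-- Division with remainder: composing with a power of the rotation by `δ` leaves a rotation by `n %
δ`, which minimality forces to be 0. -/
theorem delta_dvd (hc : c ≠ 0) {n : ℕ} {σ : Equiv.Perm V} (hσ : σ ∈ autSet G)
    (h : ∀ i, σ (L.x i) = L.x (n + i)) : L.delta ∣ n := by
  obtain ⟨hpos, ρ, hρ, hρx⟩ := L.delta_spec hc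
  by_contra hnd
  have hr : 0 < n % L.delta := Nat.pos_of_ne_zero fun h0 => hnd (Nat.dvd_of_mod_eq_zero h0)
  refine (Nat.mod_lt n hpos).not_ge (L.delta_le hr
    (autSet_mul (autSet_inv (autSet_pow hρ (n / L.delta))) hσ) fun i => ?_)
  rw [Equiv.Perm.mul_apply, Equiv.Perm.inv_eq_iff_eq, h, L.pow_apply_x hρx, ← add_assoc]
  congr 2
  exact_mod_cast congrArg (Nat.cast (R := ZMod c)) (Nat.div_add_mod' n L.delta).symm

theorem delta_dvd_card (hc : c ≠ 0) : L.delta ∣ c :=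
  L.delta_dvd hc (autSet_one G) (by simp)

theorem deg_delta_add [Finite V] (hc : c ≠ 0) (i : ZMod c) :
    deg G (L.x (L.delta + i)) = deg G (L.x i) := by
  obtain ⟨_, σ, hσ, h⟩ := L.delta_spec hc
  rw [← h, deg_apply_of_mem_autSet hσ]

theorem delta_cast_ne_zero (hc : c ≠ 0) (hrot : ∃ ρ ∈ L.rot, ρ (L.x 0) ≠ L.x 0) :
    (L.delta : ZMod c) ≠ 0 := fun h => by
  have : NeZero c := ⟨hc⟩
  obtain ⟨ρ, ⟨hρ, α, hα⟩, hne⟩ := hrot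
  have hαpos : 0 < α.val := by
    rw [Nat.pos_iff_ne_zero, ne_eq, ZMod.val_eq_zero]
    rintro rfl
    exact hne (by simpa using hα 0)
  have h1 := L.delta_le hαpos hρ (by simpa using hα)
  have h2 := Nat.le_of_dvd (L.delta_spec hc).1 ((ZMod.natCast_eq_zero_iff _ _).1 h)
  exact absurd (ZMod.val_lt α) (by omega)

/-- The reflection in `β / 2` that exchanges the first two leaves wherever possible. -/
theorem exists_reflection [Finite V] (hG : G.Connected) (hc : 3 ≤ c) {β : ZMod c}
    (hβ : ∀ i, deg G (L.x (β - i)) = deg G (L.x i)) :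
    ∃ π ∈ autSet G, ∀ i j, (i, j) ∈ L.positions → π (L.vertexAt (i, j)) = L.vertexAt
      (β - i, if 4 ≤ deg G (L.x i) then Equiv.swap 1 2 j else j) := by
  obtain ⟨π, hπ, h⟩ := L.exists_aut hG hc (Equiv.subLeft β)
    (fun i j => by
      simp only [Equiv.subLeft_apply]
      constructor
      · rintro (h | h)
        · exact Or.inr (by linear_combination h)
        · exact Or.inl (by linear_combination h)
      · rintro (rfl | rfl)
        · exact Or.inr (by ring)
        · exact Or.inl (by ring))
    -- Labels 1 and 2 both exist at `x i` exactly when the degree is at least 4.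
    (fun i => if 4 ≤ deg G (L.x i) then Equiv.swap 1 2 else 1)
    (fun i => by split_ifs <;> rfl)
    (fun i j => by
      split_ifs with h4
      · by_cases h1 : j = 1
        · subst h1; rw [Equiv.swap_apply_left]; omega
        · by_cases h2 : j = 2
          · subst h2; rw [Equiv.swap_apply_right]; omega
          · rw [Equiv.swap_apply_of_ne_of_ne h1 h2]
      · rfl)
    hβ
  refine ⟨π, hπ, fun i j hp => ?_⟩
  rw [h i j hp]
  split_ifs <;> rfl

theorem swap_mem_positions {i : ZMod c} {j : ℕ} (hp : (i, j) ∈ L.positions) :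
    (i, if 4 ≤ deg G (L.x i) then Equiv.swap 1 2 j else j) ∈ L.positions := by
  have hp : j ≤ deg G (L.x i) - 2 := hp
  change (if 4 ≤ deg G (L.x i) then Equiv.swap 1 2 j else j) ≤ deg G (L.x i) - 2
  split_ifs with h4
  · rw [Equiv.swap_apply_def]
    split_ifs <;> omega
  · exact hp

theorem mem_positions_of_deg_eq {i i' : ZMod c} {j : ℕ} (hp : (i, j) ∈ L.positions)
    (h : deg G (L.x i') = deg G (L.x i)) : (i', j) ∈ L.positions := by
  change j ≤ deg G (L.x i') - 2
  rw [h]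
  exact hp

/-- `φ` rotates the cycle by `δ` and keeps the labels of the leaves. -/
def ShiftsLabels (φ : Equiv.Perm V) : Prop :=
  ∀ i j, (i, j) ∈ L.positions → φ (L.vertexAt (i, j)) = L.vertexAt (L.delta + i, j)

/-- The rotation by `δ` that keeps the labels of the leaves. -/
theorem exists_minimal_rotation [Finite V] (hG : G.Connected) (hc : 3 ≤ c) :
    ∃ φ ∈ autSet G, L.ShiftsLabels φ := by
  obtain ⟨φ, hφ, h⟩ := L.exists_aut hG hc (Equiv.addLeft (L.delta : ZMod c))
    (fun i j => by simp [add_assoc]) (fun _ => 1) (fun _ => rfl) (fun _ _ => Iff.rfl)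
    (L.deg_delta_add (by omega))
  exact ⟨φ, hφ, h⟩

theorem rotation_apply_x {φ : Equiv.Perm V} (hφ : L.ShiftsLabels φ) (i : ZMod c) : φ (L.x i) = L.x (L.delta + i) := by
  simpa only [vertexAt_zero] using hφ i 0 (Nat.zero_le _)

theorem ShiftsLabels.isMinimalRotation {φ : Equiv.Perm V} {L : Labelling G w c} (hφ : L.ShiftsLabels φ)
    (hφa : φ ∈ autSet G) : L.IsMinimalRotation φ := by
  refine ⟨⟨hφa, _, L.rotation_apply_x hφ⟩, L.rotation_apply_x hφ, fun i j hj => ?_⟩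
  have hj0 : j ≠ 0 := Nat.one_le_iff_ne_zero.1 hj.1
  rw [← L.vertexAt_of_ne_zero _ hj0, ← L.vertexAt_of_ne_zero _ hj0]
  exact hφ i j hj.2

theorem pow_apply_vertexAt [Finite V] {φ : Equiv.Perm V} (hφ : L.ShiftsLabels φ) (hc : c ≠ 0) (n : ℕ) {i : ZMod c} {j : ℕ}
    (hp : (i, j) ∈ L.positions) :
    (φ ^ n) (L.vertexAt (i, j)) = L.vertexAt (n * L.delta + i, j) := by
  induction n generalizing i with
  | zero => simp
  | succ n ih =>
    rw [pow_succ, Equiv.Perm.mul_apply, hφ i j hp,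
      ih (L.mem_positions_of_deg_eq hp (L.deg_delta_add hc i))]
    congr 2
    push_cast
    ring

theorem pow_eq_one [Finite V] {φ : Equiv.Perm V} (hφ : L.ShiftsLabels φ) (hG : G.Connected) (hc : 3 ≤ c) {n : ℕ}
    (hn : (n * L.delta : ZMod c) = 0) : φ ^ n = 1 :=
  L.perm_ext hG hc fun i j hp => by
    rw [L.pow_apply_vertexAt hφ (by omega) n hp, hn, zero_add, Equiv.Perm.one_apply]

theorem orderOf_rotation [Finite V] {φ : Equiv.Perm V} (hφ : L.ShiftsLabels φ) (hG : G.Connected) (hc : 3 ≤ c) : orderOf φ = c / L.delta := by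
  have hdc := L.delta_dvd_card (by omega)
  refine Nat.dvd_antisymm (orderOf_dvd_of_pow_eq_one (L.pow_eq_one hφ hG hc ?_)) ?_
  · rw [← Nat.cast_mul, Nat.div_mul_cancel hdc, ZMod.natCast_self]
  · have h := L.pow_apply_x (L.rotation_apply_x hφ) (orderOf φ) 0
    rw [pow_orderOf_eq_one, Equiv.Perm.one_apply] at h
    have h1 := L.x_injective h
    rw [add_zero, ← Nat.cast_mul, eq_comm, ZMod.natCast_eq_zero_iff] at h1
    exact (Nat.div_dvd_iff_dvd_mul hdc (L.delta_spec (by omega)).1).2 (mul_comm _ L.delta ▸ h1)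

/-- The group generated by the minimal rotation acts freely. -/
theorem eq_one_of_apply_eq [Finite V] {φ : Equiv.Perm V} (hφ : L.ShiftsLabels φ) (hG : G.Connected) (hc : 3 ≤ c) {ψ : Equiv.Perm V}
    (hψ : ψ ∈ Subgroup.zpowers φ) {u : V} (hu : ψ u = u) : ψ = 1 := by
  obtain ⟨n, rfl⟩ := exists_pow_of_mem_zpowers hψ
  obtain ⟨⟨i, j⟩, hp, rfl⟩ := (L.vertexAt_bijOn hG hc).surjOn (Set.mem_univ u)
  have hc0 : c ≠ 0 := by omega
  refine L.pow_eq_one hφ hG hc ?_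
  rw [L.pow_apply_vertexAt hφ hc0 n hp] at hu
  have hdeg : deg G (L.x (n * L.delta + i)) = deg G (L.x i) := by
    obtain ⟨_, σ, hσ, h⟩ := L.delta_spec hc0
    rw [← L.pow_apply_x h, deg_apply_of_mem_autSet (autSet_pow hσ n)]
  have := (L.vertexAt_bijOn hG hc).injOn (L.mem_positions_of_deg_eq hp hdeg) hp hu
  simpa using congrArg Prod.fst this

/-- Every rotation agrees on the cycle with a power of the minimal rotation. -/
theorem exists_mem_zpowers_of_mem_rot [Finite V] {φ : Equiv.Perm V} (hφ : L.ShiftsLabels φ) (hc : c ≠ 0) {σ : Equiv.Perm V} (hσ : σ ∈ L.rot) :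
    ∃ ψ ∈ Subgroup.zpowers φ, ∀ i, ψ (L.x i) = σ (L.x i) := by
  have : NeZero c := ⟨hc⟩
  obtain ⟨hσ, α, hα⟩ := hσ
  obtain ⟨k, hk⟩ := L.delta_dvd hc (n := α.val) hσ (by simpa using hα)
  refine ⟨φ ^ k, Subgroup.npow_mem_zpowers φ k, fun i => ?_⟩
  rw [L.pow_apply_x (L.rotation_apply_x hφ), hα]
  congr 2
  rw [← Nat.cast_mul, mul_comm, ← hk, ZMod.natCast_zmod_val]

/-- The quotient `σ * π⁻¹` of two reflections is a rotation. -/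
theorem exists_mem_zpowers_of_mem_ref [Finite V] {φ : Equiv.Perm V} (hφ : L.ShiftsLabels φ) (hc : c ≠ 0) {σ π : Equiv.Perm V} (hσ : σ ∈ L.ref)
    (hπ : π ∈ L.ref) : ∃ ψ ∈ Subgroup.zpowers φ, ∀ i, ψ (π (L.x i)) = σ (L.x i) := by
  obtain ⟨hσ, α, hα⟩ := hσ
  obtain ⟨hπ, β, hβ⟩ := hπ
  have hrot : σ * π⁻¹ ∈ L.rot := by
    refine ⟨autSet_mul hσ (autSet_inv hπ), α - β, fun i => ?_⟩
    have : π⁻¹ (L.x i) = L.x (β - i) := by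
      rw [Equiv.Perm.inv_eq_iff_eq, hβ, sub_sub_cancel]
    rw [Equiv.Perm.mul_apply, this, hα]
    congr 1
    ring
  obtain ⟨ψ, hψ, h⟩ := L.exists_mem_zpowers_of_mem_rot hφ hc hrot
  refine ⟨ψ, hψ, fun i => ?_⟩
  have := h (β - i)
  rw [← hβ] at this
  simpa using this

/-- The reflections either all keep a vertex of the cycle in its orbit or all move it out. -/
theorem apply_notMem_images [Finite V] {φ : Equiv.Perm V} (hφ : L.ShiftsLabels φ) (hc : c ≠ 0) {π : Equiv.Perm V} (hπ : π ∈ L.ref) {i : ZMod c}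
    (h : ¬ images L.ref (L.x i) ⊆ images (Subgroup.zpowers φ : Set (Equiv.Perm V)) (L.x i)) :
    π (L.x i) ∉ images (Subgroup.zpowers φ : Set (Equiv.Perm V)) (L.x i) := by
  rintro ⟨ψ, hψ, hψπ⟩
  refine h ?_
  rintro _ ⟨σ, hσ, rfl⟩
  obtain ⟨ψ', hψ', h'⟩ := L.exists_mem_zpowers_of_mem_ref hφ hc hσ hπ
  refine ⟨ψ' * ψ, mul_mem hψ' hψ, ?_⟩
  change ψ' (ψ (L.x i)) = σ (L.x i)
  rw [← h', ← hψπ]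

theorem w_eq_vertexAt : L.vertexAt (0, 1) = w :=
  (L.vertexAt_of_ne_zero 0 one_ne_zero).trans L.leaf_zero_one

theorem three_le_deg [Finite V] (hG : G.Connected) (hc : 3 ≤ c) (hw : w ∉ skelVerts G) :
    3 ≤ deg G (L.x 0) := by
  obtain ⟨j, hj, _⟩ := (L.leaf_bijOn 0).surjOn ⟨L.deg_eq_one hG hc hw, L.w_adj⟩
  have := hj.1
  have := hj.2
  omega

end Labelling

/-- A group of permutations in which only the identity fixes `v` or `w` is separated. -/
theorem separated_of_free {V : Type*} {v w : V} (D : Subgroup (Equiv.Perm V))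
    (hv : ∀ σ ∈ D, σ v = v → σ = 1) (hw : ∀ σ ∈ D, σ w = w → σ = 1) :
    Separated v w (D : Set (Equiv.Perm V)) := fun σ hσ τ hτ hne => by
  refine ⟨fun h => hne ?_, fun h => hne ?_⟩
  · have : (σ * τ⁻¹) v = v := by
      rw [Equiv.Perm.mul_apply, ← h]
      exact σ.apply_symm_apply v
    exact mul_inv_eq_one.1 (hv _ (mul_mem hσ (inv_mem hτ)) this)
  · have : (τ⁻¹ * σ) w = w := by simp [h]
    exact (inv_mul_eq_one.1 (hw _ (mul_mem (inv_mem hτ) hσ) this)).symm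

/-! ### The cyclic and the dihedral case. -/

namespace Labelling

variable {V : Type*} [Finite V] {G : SimpleGraph V} {w : V} {c : ℕ} (L : Labelling G w c)
  {φ : Equiv.Perm V}

theorem exists_isOptimum_cyclic (hG : G.Connected) (hc : 3 ≤ c) (hw : w ∉ skelVerts G)
    (hd : (L.delta : ZMod c) ≠ 0) (hφ : L.ShiftsLabels φ) (hφa : φ ∈ autSet G) (k : ZMod c)
    (h : L.CaseOne (L.x k) (Subgroup.zpowers φ) ∨ L.CaseTwo (Subgroup.zpowers φ)) :
    ∃ X, IsOptimum G (L.x k) w X ∧ X ∩ autSet G = (Subgroup.zpowers φ : Set (Equiv.Perm V)) := by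
  have hc0 : c ≠ 0 := by omega
  refine exists_isOptimum (L.activeIso_subset_autSet hG hc hw hd (L.deg_delta_add hc0))
    (fun ψ hψ => mem_autSet_of_mem_zpowers hφa hψ) (one_mem _)
    (separated_of_free _ (fun _ hσ => L.eq_one_of_apply_eq hφ hG hc hσ)
      fun _ hσ => L.eq_one_of_apply_eq hφ hG hc hσ) fun Y hY hsep => ?_
  rcases h with h | ⟨hdeg, h⟩
  · refine hsep.ncard_le_of_inv_apply_mem (a := L.x k) fun σ hσ => ?_
    rcases L.mem_rot_or_mem_ref hc hw (autSet_inv (hY hσ)) with hσ' | hσ'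
    · obtain ⟨ψ, hψ, hψσ⟩ := L.exists_mem_zpowers_of_mem_rot hφ hc0 hσ'
      exact ⟨ψ, hψ, hψσ k⟩
    · exact h ⟨_, hσ', rfl⟩
  · refine hsep.ncard_le_of_apply_mem (a := w) fun σ hσ => ?_
    have hσa := hY hσ
    have hx : ∃ ψ ∈ Subgroup.zpowers φ, ψ (L.x 0) = σ (L.x 0) := by
      rcases L.mem_rot_or_mem_ref hc hw hσa with hσ' | hσ'
      · obtain ⟨ψ, hψ, hψσ⟩ := L.exists_mem_zpowers_of_mem_rot hφ hc0 hσ'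
        exact ⟨ψ, hψ, hψσ 0⟩
      · exact h ⟨_, hσ', rfl⟩
    obtain ⟨ψ, hψ, hψσ⟩ := hx
    have hψa := mem_autSet_of_mem_zpowers hφa hψ
    refine ⟨ψ, hψ, ?_⟩
    change ψ w = σ w
    obtain ⟨l, hl⟩ : ∃ l, L.x l = σ (L.x 0) := by
      have : σ (L.x 0) ∈ skelVerts G := by
        have := deg_apply_of_mem_autSet hσa (L.x 0)
        simp only [skelVerts, Set.mem_ofPred_eq]
        omega
      rwa [← L.x_range] at this
    have hw1 := L.deg_eq_one hG hc hw
    have hdl : deg G (L.x l) = 3 := by rw [hl, deg_apply_of_mem_autSet hσa, hdeg]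
    -- Degree 3 leaves room for one leaf only, so the image of `x 0` determines that of `w`.
    have huniq : ∀ ρ ∈ autSet G, ρ (L.x 0) = L.x l → ρ w = L.leaf l 1 := fun ρ hρ hρl => by
      obtain ⟨j, hj, hjw⟩ := (L.leaf_bijOn l).surjOn (a := ρ w)
        ⟨(deg_apply_of_mem_autSet hρ w).trans hw1, hρl ▸ (hρ _ _).2 L.w_adj⟩
      rw [hdl] at hj
      rw [← hjw, show j = 1 by have := hj.1; have := hj.2; omega]
    rw [huniq ψ hψa (hψσ.trans hl.symm), huniq σ hσa hl.symm]

theorem exists_isOptimum_dihedral (hG : G.Connected) (hc : 3 ≤ c) (hw : w ∉ skelVerts G)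
    (hd : (L.delta : ZMod c) ≠ 0) (hφ : L.ShiftsLabels φ) (hφa : φ ∈ autSet G) (k : ZMod c)
    (h1 : ¬ L.CaseOne (L.x k) (Subgroup.zpowers φ)) (h2 : ¬ L.CaseTwo (Subgroup.zpowers φ)) :
    ∃ π ∈ L.ref, ∃ X, IsOptimum G (L.x k) w X ∧
      X ∩ autSet G = (Subgroup.zpowers φ : Set (Equiv.Perm V)) ∪
        (fun ψ => ψ * π) '' (Subgroup.zpowers φ : Set (Equiv.Perm V)) ∧
      ∃ D : Subgroup (Equiv.Perm V), (D : Set (Equiv.Perm V)) = X ∩ autSet G ∧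
        Nonempty (D ≃* DihedralGroup (c / L.delta)) := by
  have hc0 : c ≠ 0 := by omega
  -- Failure of case (i) supplies a reflection; only its axis is kept, and its action on the leaves
  -- is replaced.
  obtain ⟨_, ⟨ρ, ⟨hρa, β, hρ⟩, rfl⟩, -⟩ := Set.not_subset.1 h1
  have hβ : ∀ i, deg G (L.x (β - i)) = deg G (L.x i) := fun i => by
    rw [← hρ, deg_apply_of_mem_autSet hρa]
  obtain ⟨π, hπa, hπ⟩ := L.exists_reflection hG hc hβ
  have hπx : ∀ i, π (L.x i) = L.x (β - i) := fun i => by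
    have := hπ i 0 (Nat.zero_le _)
    rw [vertexAt_zero] at this
    rw [this, ← vertexAt_zero]
    split_ifs <;> rfl
  have hπref : π ∈ L.ref := ⟨hπa, β, hπx⟩
  have hπv := L.apply_notMem_images hφ hc0 hπref h1
  have hπw : π w ∉ images (Subgroup.zpowers φ : Set (Equiv.Perm V)) w := by
    rintro ⟨ψ, hψ, hψw⟩
    have hψw : ψ w = π w := hψw
    have hψa := mem_autSet_of_mem_zpowers hφa hψ
    have hd3 := L.three_le_deg hG hc hw
    by_cases h3 : deg G (L.x 0) = 3
    -- A leaf has one neighbour, so `ψ w = π w` would give `ψ (x 0) = π (x 0)`.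
    · refine L.apply_notMem_images hφ hc0 hπref (fun h => h2 ⟨h3, h⟩) ⟨ψ, hψ, ?_⟩
      refine eq_of_deg_eq_one (u := π w) ?_ (hψw ▸ (hψa _ _).2 L.w_adj)
        ((hπa _ _).2 L.w_adj)
      rw [deg_apply_of_mem_autSet hπa, L.deg_eq_one hG hc hw]
    -- Now `x 0` has degree at least 4: `w` has label 1, which powers of `φ` keep and `π` turns into
    -- 2.
    · obtain ⟨n, rfl⟩ := exists_pow_of_mem_zpowers hψ
      have hp : ∀ j ≤ 2, ((0 : ZMod c), j) ∈ L.positions := fun j hj => by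
        change j ≤ deg G (L.x 0) - 2
        omega
      have e1 := L.pow_apply_vertexAt hφ hc0 n (hp 1 (by omega))
      have e2 := hπ 0 1 (hp 1 (by omega))
      rw [if_pos (by omega), Equiv.swap_apply_left] at e2
      rw [L.w_eq_vertexAt] at e1 e2
      rw [e1, e2] at hψw
      have hn := deg_apply_of_mem_autSet hψa (L.x 0)
      rw [L.pow_apply_x (L.rotation_apply_x hφ)] at hn
      have := (L.vertexAt_bijOn hG hc).injOn (L.mem_positions_of_deg_eq (hp 1 (by omega)) hn)
        (L.mem_positions_of_deg_eq (hp 2 le_rfl) (hβ 0)) hψw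
      simpa using congrArg Prod.snd this
  have hππ : π * π = 1 := L.perm_ext hG hc fun i j hp => by
    rw [Equiv.Perm.mul_apply, hπ i j hp,
      hπ _ _ (L.mem_positions_of_deg_eq (L.swap_mem_positions hp) (hβ i)), hβ, sub_sub_cancel]
    split_ifs
    · rw [Equiv.swap_apply_self]; rfl
    · rfl
  have hdeg := L.deg_delta_add hc0
  have hφπφ : φ * (π * φ) = π := L.perm_ext hG hc fun i j hp => by
    have hp' := L.mem_positions_of_deg_eq hp (hdeg i)
    rw [Equiv.Perm.mul_apply, Equiv.Perm.mul_apply, hφ i j hp, hπ _ _ hp', hπ i j hp,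
      hφ _ _ (L.mem_positions_of_deg_eq (L.swap_mem_positions hp') (hβ _)), hdeg]
    congr 2
    ring
  have hinv : π * φ = φ⁻¹ * π := eq_inv_mul_of_mul_eq hφπφ
  have hdpos := (L.delta_spec hc0).1
  have : NeZero (c / L.delta) := ⟨(Nat.div_pos (Nat.le_of_dvd (by omega)
    (L.delta_dvd_card hc0)) hdpos).ne'⟩
  obtain ⟨D, hD, hDiso⟩ := exists_dihedral_subgroup (L.orderOf_rotation hφ hG hc) hππ hinv
    fun h => hπv ⟨π, h, rfl⟩
  have hDa : (D : Set (Equiv.Perm V)) ⊆ autSet G := by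
    rw [hD]
    rintro _ (h | ⟨ψ, hψ, rfl⟩)
    · exact mem_autSet_of_mem_zpowers hφa h
    · exact autSet_mul (mem_autSet_of_mem_zpowers hφa hψ) hπa
  -- A relation `ψ (π u) = u` would put `π u = ψ⁻¹ u` into the orbit of `u`.
  have hfree : ∀ u, π u ∉ images (Subgroup.zpowers φ : Set (Equiv.Perm V)) u →
      ∀ σ ∈ D, σ u = u → σ = 1 := fun u hu σ hσ hσu => by
    have hσ : σ ∈ (D : Set (Equiv.Perm V)) := hσ
    rw [hD] at hσ
    rcases hσ with h | ⟨ψ, hψ, rfl⟩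
    · exact L.eq_one_of_apply_eq hφ hG hc h hσu
    · exact absurd ⟨ψ⁻¹, inv_mem hψ, Equiv.Perm.inv_eq_iff_eq.2 hσu.symm⟩ hu
  obtain ⟨X, hX, hXD⟩ := exists_isOptimum (v := L.x k)
    (L.activeIso_subset_autSet hG hc hw hd hdeg) hDa D.one_mem
    (separated_of_free D (hfree _ hπv) (hfree _ hπw)) fun Y hY hsep => by
      refine hsep.ncard_le_of_inv_apply_mem (a := L.x k) fun σ hσ => ?_
      rw [hD]
      rcases L.mem_rot_or_mem_ref hc hw (autSet_inv (hY hσ)) with hσ' | hσ'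
      · obtain ⟨ψ, hψ, hψσ⟩ := L.exists_mem_zpowers_of_mem_rot hφ hc0 hσ'
        exact ⟨ψ, Or.inl hψ, hψσ k⟩
      · obtain ⟨ψ, hψ, hψσ⟩ := L.exists_mem_zpowers_of_mem_ref hφ hc0 hσ' hπref
        exact ⟨ψ * π, Or.inr ⟨ψ, hψ, rfl⟩, hψσ k⟩
  exact ⟨π, hπref, X, hX, hXD.trans hD, D, hXD.symm, hDiso⟩

end Labelling

end Supercard


/-! ### The main theorem. -/

theorem mainTheorem5 {V VU VT : Type*} [Finite V] [Finite VU] [Finite VT]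
    (U : SimpleGraph VU) (T : SimpleGraph VT) (Up : SimpleGraph V)
    (hU : Supercard.IsSunshine U) (hT : Supercard.IsCaterpillar T)
    (hUp : Supercard.IsSunshine Up) (v w : V)
    (hw : Nonempty (Supercard.deleteVertex Up w ≃g U))
    (hv : Nonempty (Supercard.deleteVertex Up v ≃g T))
    (c : ℕ) (L : Supercard.Labelling Up w c)
    (hrot : ∃ ρ ∈ L.rot, ρ (L.x 0) ≠ L.x 0) :
    -- the minimal rotation `φ` exists and generates a group `Φ` of order `c / δ`
    ∃ φ : Equiv.Perm V, L.IsMinimalRotation φ ∧ L.delta ∣ c ∧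
      ∃ Φ : Subgroup (Equiv.Perm V), Φ = Subgroup.zpowers φ ∧ Nat.card Φ = c / L.delta ∧
        (L.CaseOne v Φ ∨ L.CaseTwo Φ →
          ∃ X : Set (Equiv.Perm V), Supercard.IsOptimum Up v w X ∧
            X ∩ Supercard.autSet Up = (Φ : Set (Equiv.Perm V)) ∧
            Nonempty (Φ ≃* Multiplicative (ZMod (c / L.delta)))) ∧
        (¬ L.CaseOne v Φ ∧ ¬ L.CaseTwo Φ →
          ∃ π ∈ L.ref, ∃ X : Set (Equiv.Perm V), Supercard.IsOptimum Up v w X ∧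
            X ∩ Supercard.autSet Up =
              (Φ : Set (Equiv.Perm V)) ∪ (fun ψ => ψ * π) '' (Φ : Set (Equiv.Perm V)) ∧
            ∃ D : Subgroup (Equiv.Perm V),
              (D : Set (Equiv.Perm V)) = X ∩ Supercard.autSet Up ∧
              Nonempty (D ≃* DihedralGroup (c / L.delta))) := by
  have hc := L.three_le hUp
  have hc0 : c ≠ 0 := by omega
  have hG := hUp.1
  obtain ⟨ew⟩ := hw
  obtain ⟨ev⟩ := hv
  have hws := L.w_notMem hc hU ew
  obtain ⟨k, rfl⟩ := L.exists_x_eq hc hT ev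
  have hd := L.delta_cast_ne_zero hc0 hrot
  obtain ⟨φ, hφa, hφ⟩ := L.exists_minimal_rotation hG hc
  have hcard : Nat.card (Subgroup.zpowers φ) = c / L.delta :=
    (Nat.card_zpowers φ).trans (L.orderOf_rotation hφ hG hc)
  refine ⟨φ, hφ.isMinimalRotation hφa, L.delta_dvd_card hc0, Subgroup.zpowers φ, rfl, hcard,
    fun h => ?_, fun h => L.exists_isOptimum_dihedral hG hc hws hd hφ hφa k h.1 h.2⟩
  obtain ⟨X, hX, hXa⟩ := L.exists_isOptimum_cyclic hG hc hws hd hφ hφa k h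
  refine ⟨X, hX, hXa, ⟨(zmodMulEquivOfGenerator (g := ⟨φ, Subgroup.mem_zpowers φ⟩) ?_
    hcard).symm⟩⟩
  rintro ⟨_, n, rfl⟩
  exact ⟨n, rfl⟩
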